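/- For a probability distribution $\rho$ on $\mathbb{R}$ write $\bar\rho(x)=\rho((x,\infty))$ for its tail, $\rho^{2*}=\rho*\rho$, and $m(\rho)$ for its mean. For functions $f,g$ that are positive near $+\infty$, $f(x)\sim g(x)$ means $\lim_{x\to\infty}f(x)/g(x)=1$. The distribution $\rho$ belongs to the class $\mathcal{S}_{loc}$ (locally subexponential distributions) if for every $c>0$ one has $\rho((x+a,x+a+c])\sim\rho((x,x+c])$ for every $a\in\mathbb{R}$, and $\rho^{2*}((x,x+c])\sim 2\rho((x,x+c])$, as $x\to\infty$ (in particular $\rho((x,x+c])>0$ for all large $x$). It belongs to the class $\mathcal{S}^2_{loc}$ (second order subexponential distributions) if $\rho\in\mathcal{S}_{loc}$, $\int_{-\infty}^{\infty}|x|\,\rho(dx)<\infty$, and $$\overline{\rho^{2*}}(x)=2\bar\rho(x)+2m(\rho)\,\rho((x,x+1])+o(\rho((x,x+1]))\quad\text{as }x\to\infty.$$ For an infinitely divisible distribution $\mu$ on $\mathbb{R}$ and $t>0$, $\mu^{t*}$ denotes its $t$-th convolution power, i.e. the distribution with characteristic function $e^{t\psi(z)}$, where $\psi$ is the unique continuous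 function on $\mathbb{R}$ with $\psi(0)=0$ and $e^{\psi}$ equal to the characteristic function of $\mu$. **Statement.** Let $\mu$ be an infinitely divisible probability distribution on $\mathbb{R}_+=[0,\infty)$ such that $\mu\in\mathcal{S}_{loc}$ and $m(\mu)<\infty$. Suppose that for some $t_0>0$ the relation $$\overline{\mu^{t*}}(x)=t\,\bar\mu(x)+(t^2-t)\,m(\mu)\,\mu((x,x+1])+o(\mu((x,x+1]))\quad\text{as }x\to\infty$$ holds for $t=t_0$ and for $t=t_0+1$. Then $\mu\in\mathcal{S}^2_{loc}$. -/

import Mathlib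

open MeasureTheory Filter Topology Set

/-- The class `𝐋`: nonnegative measurable functions `g` with `g (x + a) ∼ g x` for every real `a`.
The relation `∼` is that the quotient tends to `1`; since division by zero is zero in Mathlib,
this forces `g` to be eventually positive. -/
def LongTailedFun (g : ℝ → ℝ) : Prop :=
  Measurable g ∧ (∀ x, 0 ≤ g x) ∧
    ∀ a : ℝ, Tendsto (fun x => g (x + a) / g x) atTop (𝓝 1)

/-- The class `𝓛_Δ` with `Δ = (0, c]`. -/
def IsLocallyLongTailedAt (c : ℝ) (ρ : Measure ℝ) : Prop :=
  LongTailedFun (fun x => ρ.real (Ioc x (x + c)))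

/-- The class `𝓢_Δ` with `Δ = (0, c]`. -/
def IsLocallySubexponentialAt (c : ℝ) (ρ : Measure ℝ) : Prop :=
  IsLocallyLongTailedAt c ρ ∧
    Tendsto (fun x => (ρ.conv ρ).real (Ioc x (x + c)) / (2 * ρ.real (Ioc x (x + c))))
      atTop (𝓝 1)

/-- The class `𝓢_loc` of locally subexponential distributions. -/
def IsLocallySubexponential (ρ : Measure ℝ) : Prop :=
  ∀ c : ℝ, 0 < c → IsLocallySubexponentialAt c ρ

/-- The class `𝓢²_loc` of second order subexponential distributions. -/
def IsSecondOrderSubexponential (ρ : Measure ℝ) : Prop :=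
  IsLocallySubexponential ρ ∧ Integrable (fun x : ℝ => x) ρ ∧
    (fun x => (ρ.conv ρ).real (Ioi x)
        - (2 * ρ.real (Ioi x) + 2 * (∫ y, y ∂ρ) * ρ.real (Ioc x (x + 1))))
      =o[atTop] (fun x => ρ.real (Ioc x (x + 1)))

/-- The `n`-fold convolution power of a measure on `ℝ`, the zeroth one being `δ₀`. -/
noncomputable def natConvPow (ρ : Measure ℝ) : ℕ → Measure ℝ
  | 0 => Measure.dirac 0
  | n + 1 => (natConvPow ρ n).conv ρ

/-- Infinite divisibility: for every `n ≥ 1` there is an `n`-th convolution root that is a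
probability distribution. -/
def IsInfinitelyDivisible (μ : Measure ℝ) : Prop :=
  ∀ n : ℕ, 1 ≤ n → ∃ ρ : Measure ℝ, IsProbabilityMeasure ρ ∧ natConvPow ρ n = μ

/-- `ρ` is the `t`-th convolution power of `μ`: its characteristic function is `exp (t * ψ)`, where
`ψ` is the distinguished logarithm of the characteristic function of `μ`, that is, the continuous
function with `ψ 0 = 0` and `exp ψ` equal to the characteristic function of `μ`. -/
def IsRealConvPow (μ : Measure ℝ) (t : ℝ) (ρ : Measure ℝ) : Prop :=
  IsProbabilityMeasure ρ ∧ ∃ ψ : ℝ → ℂ, Continuous ψ ∧ ψ 0 = 0 ∧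
    (∀ z, charFun μ z = Complex.exp (ψ z)) ∧
    ∀ z, charFun ρ z = Complex.exp ((t : ℂ) * ψ z)

/-- The distinguished logarithm is unique. -/
theorem distinguishedLog_unique {f g : ℝ → ℂ} (hf : Continuous f) (hg : Continuous g)
    (h0 : f 0 = g 0) (h : ∀ z, Complex.exp (f z) = Complex.exp (g z)) : f = g := by
  have key : ∀ z, ∃ n : ℤ, f z = g z + n * (2 * Real.pi * Complex.I) := fun z =>
    Complex.exp_eq_exp_iff_exists_int.1 (h z)
  choose n hn using key
  have hn' : ∀ z, ((n z : ℤ) : ℝ) = ((f z - g z) / (2 * Real.pi * Complex.I)).re := by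
    intro z
    rw [hn z, add_sub_cancel_left, mul_div_assoc, div_self Complex.two_pi_I_ne_zero]
    simp
  have hc : Continuous (fun z => ((n z : ℤ) : ℝ)) := by
    simp_rw [hn']
    exact Complex.continuous_re.comp ((hf.sub hg).div_const _)
  have hcn : Continuous n := Int.isClosedEmbedding_coe_real.isEmbedding.continuous_iff.2 hc
  have hz : ∀ z, n z = n 0 := fun z => PreconnectedSpace.constant inferInstance hcn
  have h00 : n 0 = 0 := by
    have := hn' 0
    rw [h0, sub_self] at this
    simpa using this
  funext z
  rw [hn z, hz z, h00]
  simp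

/-- For each `t` there is at most one `t`-th convolution power. -/
theorem IsRealConvPow.unique {μ ρ ρ' : Measure ℝ} {t : ℝ} (h : IsRealConvPow μ t ρ)
    (h' : IsRealConvPow μ t ρ') : ρ = ρ' := by
  obtain ⟨hp, ψ, hc, h0, hμ, hρ⟩ := h
  obtain ⟨hp', ψ', hc', h0', hμ', hρ'⟩ := h'
  have e : ψ = ψ' := distinguishedLog_unique hc hc' (by rw [h0, h0'])
    (fun z => by rw [← hμ, ← hμ'])
  refine Measure.ext_of_charFun (funext fun z => ?_)
  rw [hρ, hρ', e]

open Classical in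
/-- The `t`-th convolution power `μ^{t*}`. For infinitely divisible `μ` and `t > 0` it exists, and it
is unique; where there is no such distribution the value is the zero measure. -/
noncomputable def realConvPow (μ : Measure ℝ) (t : ℝ) : Measure ℝ :=
  if h : ∃ ρ : Measure ℝ, IsRealConvPow μ t ρ then h.choose else 0

/-- The second order expansion of the tail of the `t`-th convolution power:
`μ^{t*}((x,∞)) = t μ((x,∞)) + (t² - t) m(μ) μ((x,x+1]) + o(μ((x,x+1]))` as `x → ∞`. -/
def HasConvPowTailExpansion (μ : Measure ℝ) (t : ℝ) : Prop :=
  (fun x => (realConvPow μ t).real (Ioi x)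
      - (t * μ.real (Ioi x) + (t ^ 2 - t) * (∫ y, y ∂μ) * μ.real (Ioc x (x + 1))))
    =o[atTop] (fun x => μ.real (Ioc x (x + 1)))

/-! ### Real convolution powers of infinitely divisible distributions on the half-line -/

/-! Write `ν` for the `t₀`-th power, `F x` for `μ((x,x+1])`, `m` for the mean of `μ` and `κ = (t₀² -
t₀) m`. The expansion at `t₀` says that the defect `D = ν̄ - t₀ μ̄ - κ F` is `o(F)`. Integrating `D
(x - u)` against `μ(du)` brings in the tails of `ν * μ` and `μ * μ`. The same integral splits into
three parts: where `x - u` is large it is at most `ε` times the local mass of `μ * μ`, about `2 F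
x`; on a fixed window near `x`, `μ / F x` looks like Lebesgue measure, giving `F x ∫ D`; beyond, `D`
is the constant `1 - t₀`. The mean of `ν` is `t₀ m`, so `∫ D` over `(-1,∞)` is `1 - t₀ - κ`. Hence
the tail of `ν * μ` is `t₀` times that of `μ * μ`, plus `(1 - t₀) μ̄ + κ F + o(F)`
(`tendsto_conv_tail_sub_div`). But `ν * μ` is the power `t₀ + 1`, whose expansion is given; solving
for the tail of `μ * μ` leaves the coefficient `2 m`. The powers themselves come from
`exists_isRealConvPow`. -/

instance natConvPow.instIsProbabilityMeasure (ρ : Measure ℝ) [IsProbabilityMeasure ρ] (n : ℕ) :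
    IsProbabilityMeasure (natConvPow ρ n) := by
  induction n with
  | zero => exact inferInstanceAs (IsProbabilityMeasure (Measure.dirac 0))
  | succ n ih => exact inferInstanceAs (IsProbabilityMeasure ((natConvPow ρ n).conv ρ))

theorem charFun_natConvPow (ρ : Measure ℝ) [IsProbabilityMeasure ρ] (n : ℕ) (z : ℝ) :
    charFun (natConvPow ρ n) z = charFun ρ z ^ n := by
  induction n with
  | zero => simp [natConvPow]
  | succ n ih => rw [natConvPow, charFun_conv, ih, pow_succ]

theorem conv_Iio_zero {ρ σ : Measure ℝ} [IsProbabilityMeasure ρ] [IsProbabilityMeasure σ]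
    (hρ : ρ (Iio 0) = 0) (hσ : σ (Iio 0) = 0) : (ρ.conv σ) (Iio 0) = 0 := by
  rw [Measure.conv, Measure.map_apply (by fun_prop) measurableSet_Iio]
  refine measure_mono_null (t := Iio 0 ×ˢ univ ∪ univ ×ˢ Iio 0) ?_ ?_
  · rintro ⟨a, b⟩ h
    simp only [mem_preimage, mem_Iio] at h
    by_cases ha : a < 0
    · exact Or.inl ⟨ha, mem_univ _⟩
    · exact Or.inr ⟨mem_univ _, by simp only [mem_Iio]; linarith⟩
  · exact measure_union_null (by rw [Measure.prod_prod, hρ, zero_mul])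
      (by rw [Measure.prod_prod, hσ, mul_zero])

theorem natConvPow_Iio_zero {ρ : Measure ℝ} [IsProbabilityMeasure ρ] (hρ : ρ (Iio 0) = 0) (n : ℕ) :
    natConvPow ρ n (Iio 0) = 0 := by
  induction n with
  | zero => simp [natConvPow]
  | succ n ih => exact conv_Iio_zero ih hρ

/-- A sum of negative terms is negative, so a root with negative mass would pass some on to its
powers. -/
theorem Iio_zero_eq_zero_of_natConvPow {ρ : Measure ℝ} [IsProbabilityMeasure ρ] {n : ℕ}
    (hn : 1 ≤ n) (h : natConvPow ρ n (Iio 0) = 0) : ρ (Iio 0) = 0 := by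
  induction n, hn using Nat.le_induction with
  | base => simpa [natConvPow] using h
  | succ n _ ih =>
    have key : natConvPow ρ n (Iio 0) * ρ (Iio 0) ≤ natConvPow ρ (n + 1) (Iio 0) := by
      rw [natConvPow, Measure.conv, Measure.map_apply (by fun_prop) measurableSet_Iio,
        ← Measure.prod_prod]
      refine measure_mono ?_
      rintro ⟨a, b⟩ ⟨ha, hb⟩
      simp only [mem_preimage, mem_Iio] at *
      linarith
    rw [h, nonpos_iff_eq_zero, mul_eq_zero] at key
    exact key.elim ih id

/-! ### Laplace transforms and nonvanishing characteristic functions -/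

theorem ae_nonneg_of_Iio_zero {ρ : Measure ℝ} (h : ρ (Iio 0) = 0) : ∀ᵐ u ∂ρ, 0 ≤ u := by
  rw [ae_iff]
  simpa [Iio_def] using h

theorem integrable_exp_neg {ρ : Measure ℝ} [IsProbabilityMeasure ρ] (h : ρ (Iio 0) = 0) :
    Integrable (fun u => Real.exp (-u)) ρ := by
  refine Integrable.of_bound (by fun_prop) 1 ?_
  filter_upwards [ae_nonneg_of_Iio_zero h] with u hu
  rw [Real.norm_of_nonneg (Real.exp_pos _).le]
  exact Real.exp_le_one_iff.2 (by linarith)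

theorem integral_exp_neg_natConvPow {ρ : Measure ℝ} [IsProbabilityMeasure ρ] (h : ρ (Iio 0) = 0)
    (n : ℕ) : ∫ u, Real.exp (-u) ∂(natConvPow ρ n) = (∫ u, Real.exp (-u) ∂ρ) ^ n := by
  induction n with
  | zero => simp [natConvPow]
  | succ n ih =>
    rw [natConvPow, integral_conv (integrable_exp_neg (natConvPow_Iio_zero h (n + 1)))]
    simp_rw [neg_add, Real.exp_add, integral_const_mul, integral_mul_const]
    rw [ih, pow_succ]

/-- The left side is at most `min (|z| u) 2`, while `1 - exp (-u)` is at least `u / 2` for `u ≤ 1`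
and at least `1 / 2` beyond. Integrated, this lets the Laplace transform at `1` control the
characteristic function. -/
theorem norm_exp_sub_one_le_mul_one_sub_exp_neg (z : ℝ) {u : ℝ} (hu : 0 ≤ u) :
    ‖Complex.exp (z * u * Complex.I) - 1‖ ≤ (2 * |z| + 4) * (1 - Real.exp (-u)) := by
  have e : (z * u * Complex.I : ℂ) = Complex.I * ((z * u : ℝ) : ℂ) := by push_cast; ring
  have h1 : ‖Complex.exp (z * u * Complex.I) - 1‖ ≤ |z| * u := by
    rw [e]
    refine (Real.norm_exp_I_mul_ofReal_sub_one_le).trans ?_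
    rw [Real.norm_eq_abs, abs_mul, abs_of_nonneg hu]
  have h2 : ‖Complex.exp (z * u * Complex.I) - 1‖ ≤ 2 := by
    refine (norm_sub_le _ _).trans ?_
    rw [e, Complex.norm_exp_I_mul_ofReal, norm_one]
    norm_num
  have h3 : Real.exp (-u) * (1 + u) ≤ 1 := by
    have := Real.add_one_le_exp u
    calc Real.exp (-u) * (1 + u) ≤ Real.exp (-u) * Real.exp u := by gcongr; linarith
      _ = 1 := by rw [← Real.exp_add]; simp
  have h4 := Real.exp_pos (-u)
  have hz := abs_nonneg z
  rcases le_total u 1 with h | h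
  · have : u / 2 ≤ 1 - Real.exp (-u) := by nlinarith
    nlinarith [mul_le_mul_of_nonneg_left this hz]
  · have : 1 / 2 ≤ 1 - Real.exp (-u) := by nlinarith
    nlinarith [mul_le_mul_of_nonneg_left this hz]

theorem norm_charFun_sub_one_le {ρ : Measure ℝ} [IsProbabilityMeasure ρ] (h : ρ (Iio 0) = 0)
    (z : ℝ) : ‖charFun ρ z - 1‖ ≤ (2 * |z| + 4) * (1 - ∫ u, Real.exp (-u) ∂ρ) := by
  have hi : Integrable (fun u : ℝ => Complex.exp (z * u * Complex.I)) ρ := by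
    refine Integrable.of_bound (by fun_prop) 1 (ae_of_all _ fun u => ?_)
    have e : (z * u * Complex.I : ℂ) = ((z * u : ℝ) : ℂ) * Complex.I := by push_cast; ring
    rw [e, Complex.norm_exp_ofReal_mul_I]
  have e1 : charFun ρ z - 1 = ∫ u, (Complex.exp (z * u * Complex.I) - 1) ∂ρ := by
    rw [integral_sub hi (integrable_const _), charFun_apply_real]
    simp
  have e2 : (2 * |z| + 4) * (1 - ∫ u, Real.exp (-u) ∂ρ)
      = ∫ u, (2 * |z| + 4) * (1 - Real.exp (-u)) ∂ρ := by
    rw [integral_const_mul, integral_sub (integrable_const _) (integrable_exp_neg h)]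
    simp
  rw [e1, e2]
  refine norm_integral_le_of_norm_le
    (((integrable_const _).sub (integrable_exp_neg h)).const_mul _) ?_
  filter_upwards [ae_nonneg_of_Iio_zero h] with u hu
  exact norm_exp_sub_one_le_mul_one_sub_exp_neg z hu

/-- The `n`-th root has Laplace transform `a ^ (1 / n)` at `1`, which tends to `1`. For large `n`
its characteristic function at `z` is therefore within distance less than `1` of `1`, so neither it
nor its `n`-th power vanishes. -/
theorem IsInfinitelyDivisible.charFun_ne_zero {μ : Measure ℝ} [IsProbabilityMeasure μ]
    (hdiv : IsInfinitelyDivisible μ) (hsupp : μ (Iio 0) = 0) (z : ℝ) : charFun μ z ≠ 0 := by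
  set a := ∫ u, Real.exp (-u) ∂μ with ha
  have ha0 : 0 < a := integral_exp_pos (integrable_exp_neg hsupp)
  have hlim : Tendsto (fun n : ℕ => (2 * |z| + 4) * (1 - a ^ ((n : ℝ)⁻¹))) atTop (𝓝 0) := by
    have h1 : Tendsto (fun n : ℕ => a ^ ((n : ℝ)⁻¹)) atTop (𝓝 (a ^ (0 : ℝ))) :=
      (Real.continuousAt_const_rpow ha0.ne').tendsto.comp
        (tendsto_inv_atTop_zero.comp tendsto_natCast_atTop_atTop)
    simpa using (h1.const_sub 1).const_mul (2 * |z| + 4)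
  obtain ⟨n, hn, hn1⟩ := ((hlim.eventually_lt_const one_pos).and (eventually_ge_atTop 1)).exists
  obtain ⟨ρ, hρ, hpow⟩ := hdiv n hn1
  have hρ0 : ρ (Iio 0) = 0 := Iio_zero_eq_zero_of_natConvPow hn1 (by rw [hpow, hsupp])
  have hLap : ∫ u, Real.exp (-u) ∂ρ = a ^ ((n : ℝ)⁻¹) := by
    rw [ha, ← hpow, integral_exp_neg_natConvPow hρ0,
      Real.pow_rpow_inv_natCast (integral_nonneg fun _ => (Real.exp_pos _).le) (by omega)]
  have hlt : ‖charFun ρ z - 1‖ < 1 := by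
    refine (norm_charFun_sub_one_le hρ0 z).trans_lt ?_
    rwa [hLap]
  rw [← hpow, charFun_natConvPow]
  refine pow_ne_zero _ fun h0 => ?_
  rw [h0] at hlt
  simp at hlt

/-- A nonvanishing continuous function on `ℝ` with value `1` at `0` has a continuous logarithm
vanishing at `0`. -/
theorem exists_distinguishedLog {φ : ℝ → ℂ} (hφ : Continuous φ) (h0 : φ 0 = 1)
    (hne : ∀ z, φ z ≠ 0) :
    ∃ ψ : ℝ → ℂ, Continuous ψ ∧ ψ 0 = 0 ∧ ∀ z, φ z = Complex.exp (ψ z) := by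
  obtain ⟨F, ⟨hF0, hF⟩, -⟩ := Complex.isCoveringMapOn_exp.existsUnique_continuousMap_lifts
    (⟨φ, hφ⟩ : C(ℝ, ℂ)) (a₀ := 0) (e₀ := 0) (by simp [h0]) (fun z => by simpa using hne z)
  exact ⟨F, F.continuous, hF0, fun z => (congrFun hF z).symm⟩

/-- If `η` is the distinguished logarithm for the root, then `n * η` and `ψ` are both continuous
logarithms for `μ` vanishing at `0`, hence equal. -/
theorem charFun_root_eq_exp {μ ρ : Measure ℝ} [IsProbabilityMeasure ρ] {n : ℕ} (hn : 1 ≤ n)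
    (hpow : natConvPow ρ n = μ) {ψ : ℝ → ℂ} (hψ : Continuous ψ) (hψ0 : ψ 0 = 0)
    (hμ : ∀ z, charFun μ z = Complex.exp (ψ z)) (z : ℝ) :
    charFun ρ z = Complex.exp (ψ z / n) := by
  have hpz : ∀ z, charFun ρ z ^ n = Complex.exp (ψ z) := fun z => by
    rw [← hμ, ← hpow, charFun_natConvPow]
  have hn0 : (n : ℂ) ≠ 0 := by exact_mod_cast (by omega : n ≠ 0)
  obtain ⟨η, hη, hη0, hηρ⟩ := exists_distinguishedLog (φ := charFun ρ) continuous_charFun (by simp)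
    (fun z h => by
      have := hpz z
      rw [h, zero_pow (by omega)] at this
      exact Complex.exp_ne_zero _ this.symm)
  have : (fun z => n * η z) = ψ := distinguishedLog_unique (by fun_prop) hψ (by simp [hη0, hψ0])
    (fun z => by rw [Complex.exp_nat_mul, ← hηρ, hpz])
  rw [hηρ, ← congrFun this z, mul_div_cancel_left₀ _ hn0]

/-! ### Existence of real powers and their means -/

/-- Continuity of the limit at `0` gives tightness, and Prokhorov's theorem gives compactness.
Keeping the weak convergence along `U` allows support information to pass to the limit. -/
theorem exists_tendsto_ultrafilter_of_tendsto_charFun {ν : ℕ → ProbabilityMeasure ℝ} {f : ℝ → ℂ}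
    (hf : Continuous f) (h : ∀ z, Tendsto (fun n => charFun (ν n : Measure ℝ) z) atTop (𝓝 (f z))) :
    ∃ (U : Ultrafilter ℕ) (σ : ProbabilityMeasure ℝ), (U : Filter ℕ) ≤ atTop ∧
      Tendsto ν U (𝓝 σ) ∧ ∀ z, charFun (σ : Measure ℝ) z = f z := by
  have htight := isTightMeasureSet_of_tendsto_charFun
    (μ := fun n => (ν n : Measure ℝ)) hf.continuousAt h
  have hc : IsCompact (closure (range ν)) := isCompact_closure_of_isTightMeasureSet (by
    convert htight using 1
    ext m
    simp)
  let U : Ultrafilter ℕ := Ultrafilter.of atTop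
  have hU : (U : Filter ℕ) ≤ atTop := Ultrafilter.of_le _
  obtain ⟨σ, -, hσ⟩ := hc.ultrafilter_le_nhds (U.map ν) (by
    rw [le_principal_iff]
    exact Eventually.of_forall (f := (U : Filter ℕ)) fun n => subset_closure (mem_range_self n))
  have hσ' : Tendsto ν U (𝓝 σ) := hσ
  refine ⟨U, σ, hU, hσ', fun z => ?_⟩
  refine tendsto_nhds_unique ?_ ((h z).mono_left hU)
  have := (ProbabilityMeasure.tendsto_iff_forall_integral_rclike_tendsto ℂ).1 hσ'
    (BoundedContinuousFunction.innerProbChar z)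
  simpa only [charFun_eq_integral_innerProbChar] using this

theorem exists_isRealConvPow {μ : Measure ℝ} [IsProbabilityMeasure μ]
    (hdiv : IsInfinitelyDivisible μ) (hsupp : μ (Iio 0) = 0) {t : ℝ} (ht : 0 < t) :
    ∃ ρ : Measure ℝ, IsRealConvPow μ t ρ ∧ ρ (Iio 0) = 0 := by
  obtain ⟨ψ, hψ, hψ0, hμ⟩ := exists_distinguishedLog (φ := charFun μ) continuous_charFun (by simp)
    (hdiv.charFun_ne_zero hsupp)
  choose ρ hρ hpow using fun n : ℕ => hdiv (n + 1) (by omega)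
  have hρ0 : ∀ n, ρ n (Iio 0) = 0 := fun n =>
    Iio_zero_eq_zero_of_natConvPow (n := n + 1) (by omega) (by rw [hpow, hsupp])
  -- The `⌊t (n + 1)⌋`-th power of the `(n + 1)`-th root approximates the `t`-th power.
  let k : ℕ → ℕ := fun n => ⌊t * ((n + 1 : ℕ) : ℝ)⌋₊
  let ν : ℕ → ProbabilityMeasure ℝ := fun n => ⟨natConvPow (ρ n) (k n), inferInstance⟩
  have hk : Tendsto (fun n : ℕ => (k n : ℝ) / ((n + 1 : ℕ) : ℝ)) atTop (𝓝 t) :=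
    (tendsto_nat_floor_mul_div_atTop (R := ℝ) ht.le).comp
      ((tendsto_natCast_atTop_atTop (R := ℝ)).comp (tendsto_add_atTop_nat 1))
  have hchar : ∀ z, Tendsto (fun n => charFun (ν n : Measure ℝ) z) atTop
      (𝓝 (Complex.exp ((t : ℂ) * ψ z))) := fun z => by
    have e : ∀ n, charFun (ν n : Measure ℝ) z
        = Complex.exp ((((k n : ℝ) / ((n + 1 : ℕ) : ℝ) : ℝ) : ℂ) * ψ z) := fun n => by
      change charFun (natConvPow (ρ n) (k n)) z = _
      rw [charFun_natConvPow, charFun_root_eq_exp (by omega) (hpow n) hψ hψ0 hμ,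
        ← Complex.exp_nat_mul]
      congr 1
      push_cast
      ring
    simp_rw [e]
    refine (Complex.continuous_exp.tendsto _).comp (Tendsto.mul_const _ ?_)
    exact (Complex.continuous_ofReal.tendsto _).comp hk
  obtain ⟨U, σ, -, hσ, hσc⟩ := exists_tendsto_ultrafilter_of_tendsto_charFun (by fun_prop) hchar
  refine ⟨σ, ⟨inferInstance, ψ, hψ, hψ0, hμ, hσc⟩, ?_⟩
  -- Portmanteau: the mass of an open set cannot jump up in a weak limit.
  have hle := ProbabilityMeasure.le_liminf_measure_open_of_tendsto hσ (isOpen_Iio (a := (0 : ℝ)))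
  have hz : ∀ n, (ν n : Measure ℝ) (Iio 0) = 0 := fun n => natConvPow_Iio_zero (hρ0 n) _
  simpa [hz] using hle

theorem isRealConvPow_realConvPow {μ : Measure ℝ} {t : ℝ} (h : ∃ ρ, IsRealConvPow μ t ρ) :
    IsRealConvPow μ t (realConvPow μ t) := by
  rw [realConvPow, dif_pos h]
  exact h.choose_spec

theorem IsRealConvPow.realConvPow_eq {μ ρ : Measure ℝ} {t : ℝ} (h : IsRealConvPow μ t ρ) :
    realConvPow μ t = ρ :=
  (isRealConvPow_realConvPow ⟨ρ, h⟩).unique h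

theorem IsRealConvPow.conv_self {μ ρ : Measure ℝ} [IsProbabilityMeasure μ] {t : ℝ}
    (h : IsRealConvPow μ t ρ) : IsRealConvPow μ (t + 1) (ρ.conv μ) := by
  obtain ⟨hp, ψ, hψ, hψ0, hμ, hρ⟩ := h
  refine ⟨inferInstance, ψ, hψ, hψ0, hμ, fun z => ?_⟩
  rw [charFun_conv, hρ, hμ, ← Complex.exp_add]
  congr 1
  push_cast
  ring

theorem hasDerivAt_charFun_zero {ρ : Measure ℝ} [IsProbabilityMeasure ρ]
    (h : Integrable (fun x : ℝ => x) ρ) :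
    HasDerivAt (charFun ρ) (Complex.I * ((∫ x, x ∂ρ : ℝ) : ℂ)) 0 := by
  have hm : MemLp id (1 : ℕ) ρ := by
    rw [Nat.cast_one]
    exact memLp_one_iff_integrable.2 h
  have hd : DifferentiableAt ℝ (charFun ρ) 0 :=
    ((contDiff_charFun hm).differentiable (by norm_num)).differentiableAt
  have := iteratedDeriv_charFun_zero hm
  simp only [iteratedDeriv_one, pow_one] at this
  rw [← this]
  exact hd.hasDerivAt

/-- The mean of the `t`-th convolution power is `t` times the mean. -/
theorem IsRealConvPow.integral_id {μ ρ : Measure ℝ} [IsProbabilityMeasure μ] {t : ℝ}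
    (h : IsRealConvPow μ t ρ) (hμi : Integrable (fun x : ℝ => x) μ)
    (hρi : Integrable (fun x : ℝ => x) ρ) : ∫ x, x ∂ρ = t * ∫ x, x ∂μ := by
  obtain ⟨hp, ψ, hψ, hψ0, hμ, hρ⟩ := h
  have h1 := hasDerivAt_charFun_zero hμi
  have h2 := hasDerivAt_charFun_zero hρi
  have hlog : HasDerivAt (fun z => Complex.log (charFun μ z))
      (Complex.I * ((∫ x, x ∂μ : ℝ) : ℂ)) 0 := by
    have := h1.clog_real (by simp)
    simpa using this
  have him : Tendsto (fun z => (ψ z).im) (𝓝 0) (𝓝 0) := by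
    have : Continuous fun z => (ψ z).im := by fun_prop
    simpa [hψ0] using this.tendsto 0
  -- Near `0` the imaginary part of `ψ` lies in `(-π, π)`, so `ψ` is the principal logarithm there
  -- and inherits its derivative.
  have hev : ψ =ᶠ[𝓝 0] fun z => Complex.log (charFun μ z) := by
    filter_upwards [him.eventually_lt_const Real.pi_pos,
      him.eventually_const_lt (neg_lt_zero.2 Real.pi_pos)] with z hz1 hz2
    rw [hμ, Complex.log_exp hz2 hz1.le]
  have hψd := hlog.congr_of_eventuallyEq hev
  have h3 := (hψd.const_mul (t : ℂ)).cexp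
  rw [show (fun z => Complex.exp ((t : ℂ) * ψ z)) = charFun ρ from funext fun z => (hρ z).symm] at h3
  have h4 := h2.unique h3
  rw [hψ0, mul_zero, Complex.exp_zero, one_mul, mul_left_comm] at h4
  exact_mod_cast mul_left_cancel₀ Complex.I_ne_zero h4

/-! ### Local weak convergence for locally long-tailed distributions -/

theorem eventually_pos_of_tendsto_div {f g : ℝ → ℝ} {a : ℝ} (ha : a ≠ 0) (hg : ∀ x, 0 ≤ g x)
    (h : Tendsto (fun x => f x / g x) atTop (𝓝 a)) : ∀ᶠ x in atTop, 0 < g x := by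
  filter_upwards [h.eventually_ne ha] with x hx
  refine (hg x).lt_of_ne fun h0 => hx ?_
  rw [← h0, div_zero]

theorem measureReal_Ioc_add_nat_mul (μ : Measure ℝ) [IsFiniteMeasure μ] {c : ℝ} (hc : 0 ≤ c)
    (x : ℝ) (n : ℕ) : μ.real (Ioc x (x + n * c))
      = ∑ k ∈ Finset.range n, μ.real (Ioc (x + k * c) (x + k * c + c)) := by
  induction n with
  | zero => simp
  | succ n ih =>
    have hn : (0 : ℝ) ≤ n * c := by positivity
    rw [Finset.sum_range_succ, ← ih, ← measureReal_union
      (by rw [Set.disjoint_left]; rintro u ⟨-, h1⟩ ⟨h2, -⟩; linarith) measurableSet_Ioc,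
      Ioc_union_Ioc_eq_Ioc (by linarith) (by linarith)]
    congr 2
    push_cast
    ring

/-- A unit window splits into `n` windows of length `1 / n`, all asymptotically of the same mass. -/
theorem tendsto_measureReal_Ioc_inv_nat {μ : Measure ℝ} [IsFiniteMeasure μ]
    (h : ∀ c : ℝ, 0 < c → IsLocallyLongTailedAt c μ) {n : ℕ} (hn : 0 < n) (a : ℝ) :
    Tendsto (fun x => μ.real (Ioc (x + a) (x + a + (n : ℝ)⁻¹)) / μ.real (Ioc x (x + 1)))
      atTop (𝓝 (n : ℝ)⁻¹) := by
  have hn' : (0 : ℝ) < n := by exact_mod_cast hn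
  obtain ⟨-, hpos, hlim⟩ := h (n : ℝ)⁻¹ (by positivity)
  set g : ℝ → ℝ := fun x => μ.real (Ioc x (x + (n : ℝ)⁻¹)) with hg
  have hsum : Tendsto (fun x => μ.real (Ioc x (x + 1)) / g x) atTop (𝓝 n) := by
    have h1 : ∀ x, μ.real (Ioc x (x + 1)) / g x
        = ∑ k ∈ Finset.range n, g (x + k * (n : ℝ)⁻¹) / g x := fun x => by
      rw [← Finset.sum_div, hg, ← measureReal_Ioc_add_nat_mul μ (by positivity),
        mul_inv_cancel₀ hn'.ne']
    simp_rw [h1]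
    have := tendsto_finsetSum (Finset.range n) fun k _ => hlim (k * (n : ℝ)⁻¹)
    simpa using this
  have hgpos := eventually_pos_of_tendsto_div one_ne_zero hpos (hlim 0)
  have := (hlim a).mul (hsum.inv₀ hn'.ne')
  rw [one_mul] at this
  refine this.congr' ?_
  filter_upwards [hgpos] with x hx
  rw [inv_div, div_mul_div_cancel₀ hx.ne']

theorem intervalIntegral_comp_sub_mem_Icc {μ : Measure ℝ} [IsFiniteMeasure μ] {g : ℝ → ℝ}
    (hg : Antitone g) {p q : ℝ} (hpq : p ≤ q) (x : ℝ) :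
    (∫ u in (x - q)..(x - p), g (x - u) ∂μ) ∈
      Icc (g q * μ.real (Ioc (x - q) (x - p))) (g p * μ.real (Ioc (x - q) (x - p))) := by
  have hmono : Monotone fun u => g (x - u) := fun u v huv => hg (by linarith)
  have hint : IntegrableOn (fun u => g (x - u)) (Ioc (x - q) (x - p)) μ :=
    (intervalIntegrable_iff_integrableOn_Ioc_of_le (by linarith)).1 hmono.intervalIntegrable
  have hconst : ∀ c : ℝ, c * μ.real (Ioc (x - q) (x - p)) = ∫ _ in Ioc (x - q) (x - p), c ∂μ :=
    fun c => by simp [mul_comm]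
  rw [intervalIntegral.integral_of_le (by linarith), hconst, hconst]
  refine ⟨setIntegral_mono_on integrableOn_const hint measurableSet_Ioc fun u hu => hg ?_,
    setIntegral_mono_on hint integrableOn_const measurableSet_Ioc fun u hu => hg ?_⟩
  · linarith [hu.1]
  · linarith [hu.2]

theorem intervalIntegral_mem_Icc {g : ℝ → ℝ} (hg : Antitone g) {p q : ℝ} (hpq : p ≤ q) :
    (∫ y in p..q, g y) ∈ Icc (g q * (q - p)) (g p * (q - p)) := by
  have hint : IntervalIntegrable g volume p q := hg.intervalIntegrable
  have hconst : ∀ c : ℝ, c * (q - p) = ∫ _ in p..q, c := fun c => by simp [mul_comm]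
  rw [hconst, hconst]
  exact ⟨intervalIntegral.integral_mono_on hpq intervalIntegrable_const hint fun u hu => hg hu.2,
    intervalIntegral.integral_mono_on hpq hint intervalIntegrable_const fun u hu => hg hu.1⟩

/-- For a locally long-tailed distribution, the normalized restrictions of `μ` to windows of fixed
integer length converge to Lebesgue measure when tested against antitone functions. -/
theorem tendsto_intervalIntegral_comp_sub_div {μ : Measure ℝ} [IsFiniteMeasure μ]
    (h : ∀ c : ℝ, 0 < c → IsLocallyLongTailedAt c μ) {g : ℝ → ℝ} (hg : Antitone g) (a : ℝ) (L : ℕ) :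
    Tendsto (fun x => (∫ u in (x - (a + L))..(x - a), g (x - u) ∂μ) / μ.real (Ioc x (x + 1)))
      atTop (𝓝 (∫ y in a..(a + L), g y)) := by
  rw [Metric.tendsto_atTop']
  intro ε hε
  -- With mesh `1 / n`, the upper and lower sums of the antitone `g` telescope to a gap of `(g a - g
  -- (a + L)) / n`, which this `n` makes less than `ε / 2`.
  obtain ⟨n, hn⟩ := exists_nat_gt ((g a - g (a + L)) / (ε / 2))
  have hgap : 0 ≤ g a - g (a + L) := sub_nonneg.2 (hg (by simp))
  have hn' : (0 : ℝ) < n := lt_of_le_of_lt (by positivity) hn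
  have hn0 : 0 < n := by exact_mod_cast hn'
  let p : ℕ → ℝ := fun k => a + k * (n : ℝ)⁻¹
  have hp0 : p 0 = a := by simp [p]
  have hpN : p (L * n) = a + L := by simp [p, hn'.ne']
  have hps : ∀ k, p (k + 1) = p k + (n : ℝ)⁻¹ := fun k => by simp only [p]; push_cast; ring
  have hple : ∀ k, p k ≤ p (k + 1) := fun k => by rw [hps]; linarith [inv_pos.2 hn']
  let w : ℕ → ℝ → ℝ := fun k x => μ.real (Ioc (x - p (k + 1)) (x - p k))
  have hw : ∀ k, Tendsto (fun x => w k x / μ.real (Ioc x (x + 1))) atTop (𝓝 (n : ℝ)⁻¹) := fun k => by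
    refine (tendsto_measureReal_Ioc_inv_nat h hn0 (-p (k + 1))).congr fun x => ?_
    simp only [w]
    rw [show x + -p (k + 1) + (n : ℝ)⁻¹ = x - p k by rw [hps]; ring, ← sub_eq_add_neg]
  have hJ : ∀ x, (∫ u in (x - (a + L))..(x - a), g (x - u) ∂μ)
      = ∑ k ∈ Finset.range (L * n), ∫ u in (x - p (k + 1))..(x - p k), g (x - u) ∂μ := fun x => by
    have hmono : Monotone fun u => g (x - u) := fun u v huv => hg (by linarith)
    have := intervalIntegral.sum_integral_adjacent_intervals (μ := μ) (n := L * n)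
      (f := fun u => g (x - u)) (a := fun k => x - p k) fun k _ => hmono.intervalIntegrable
    rw [hp0, hpN] at this
    rw [intervalIntegral.integral_symm, ← this, ← Finset.sum_neg_distrib]
    exact Finset.sum_congr rfl fun k _ => (intervalIntegral.integral_symm _ _).symm
  have hI : (∫ y in a..(a + L), g y) = ∑ k ∈ Finset.range (L * n), ∫ y in p k..p (k + 1), g y := by
    rw [intervalIntegral.sum_integral_adjacent_intervals fun k _ => hg.intervalIntegrable, hp0, hpN]
  have hIk := fun k => intervalIntegral_mem_Icc hg (hple k)
  have hIU : (∫ y in a..(a + L), g y) ≤ ∑ k ∈ Finset.range (L * n), g (p k) * (n : ℝ)⁻¹ := by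
    rw [hI]
    refine Finset.sum_le_sum fun k _ => (hIk k).2.trans_eq ?_
    rw [hps, add_sub_cancel_left]
  have hIV : ∑ k ∈ Finset.range (L * n), g (p (k + 1)) * (n : ℝ)⁻¹ ≤ ∫ y in a..(a + L), g y := by
    rw [hI]
    refine Finset.sum_le_sum fun k _ => Eq.trans_le ?_ (hIk k).1
    rw [hps, add_sub_cancel_left]
  have hUV : ∑ k ∈ Finset.range (L * n), g (p k) * (n : ℝ)⁻¹
      - ∑ k ∈ Finset.range (L * n), g (p (k + 1)) * (n : ℝ)⁻¹ < ε / 2 := by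
    rw [← Finset.sum_mul, ← Finset.sum_mul, ← sub_mul, ← Finset.sum_sub_distrib,
      Finset.sum_range_sub' (fun k => g (p k)), hp0, hpN, ← div_eq_mul_inv, div_lt_iff₀ hn']
    rwa [div_lt_iff₀ (by positivity), mul_comm] at hn
  have hU : Tendsto (fun x => ∑ k ∈ Finset.range (L * n), g (p k) * (w k x / μ.real (Ioc x (x + 1))))
      atTop (𝓝 (∑ k ∈ Finset.range (L * n), g (p k) * (n : ℝ)⁻¹)) :=
    tendsto_finsetSum _ fun k _ => (hw k).const_mul _
  have hV : Tendsto
      (fun x => ∑ k ∈ Finset.range (L * n), g (p (k + 1)) * (w k x / μ.real (Ioc x (x + 1))))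
      atTop (𝓝 (∑ k ∈ Finset.range (L * n), g (p (k + 1)) * (n : ℝ)⁻¹)) :=
    tendsto_finsetSum _ fun k _ => (hw k).const_mul _
  have hev : ∀ᶠ x in atTop, dist ((∫ u in (x - (a + L))..(x - a), g (x - u) ∂μ)
      / μ.real (Ioc x (x + 1))) (∫ y in a..(a + L), g y) < ε := by
    filter_upwards [hU.eventually_lt_const (lt_add_of_pos_right _ (half_pos hε)),
      hV.eventually_const_lt (sub_lt_self _ (half_pos hε))] with x hxU hxV
    have hJk := fun k => intervalIntegral_comp_sub_mem_Icc (μ := μ) hg (hple k) x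
    have hF : 0 ≤ μ.real (Ioc x (x + 1)) := measureReal_nonneg
    have h1 : (∫ u in (x - (a + L))..(x - a), g (x - u) ∂μ) / μ.real (Ioc x (x + 1))
        ≤ ∑ k ∈ Finset.range (L * n), g (p k) * (w k x / μ.real (Ioc x (x + 1))) := by
      rw [hJ, Finset.sum_div]
      refine Finset.sum_le_sum fun k _ => ?_
      rw [← mul_div_assoc]
      exact div_le_div_of_nonneg_right (hJk k).2 hF
    have h2 : ∑ k ∈ Finset.range (L * n), g (p (k + 1)) * (w k x / μ.real (Ioc x (x + 1)))
        ≤ (∫ u in (x - (a + L))..(x - a), g (x - u) ∂μ) / μ.real (Ioc x (x + 1)) := by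
      rw [hJ, Finset.sum_div]
      refine Finset.sum_le_sum fun k _ => ?_
      rw [← mul_div_assoc]
      exact div_le_div_of_nonneg_right (hJk k).1 hF
    rw [Real.dist_eq, abs_lt]
    constructor <;> linarith
  obtain ⟨N, hN⟩ := eventually_atTop.1 hev
  exact ⟨N, fun x hx => hN x hx.le⟩

/-! ### Tails and means of distributions on the half-line -/

theorem antitone_measureReal_Ioi (ρ : Measure ℝ) [IsFiniteMeasure ρ] :
    Antitone fun x => ρ.real (Ioi x) :=
  fun _ _ h => measureReal_mono (Ioi_subset_Ioi h)

theorem measureReal_Ioc_eq_sub (ρ : Measure ℝ) [IsFiniteMeasure ρ] {x y : ℝ} (h : x ≤ y) :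
    ρ.real (Ioc x y) = ρ.real (Ioi x) - ρ.real (Ioi y) := by
  rw [← Ioc_union_Ioi_eq_Ioi h, measureReal_union
    (by rw [Set.disjoint_left]; rintro u ⟨-, h1⟩ h2; exact not_lt.2 h1 h2) measurableSet_Ioi]
  ring

theorem measureReal_Ioi_of_neg {ρ : Measure ℝ} [IsProbabilityMeasure ρ] (h : ρ (Iio 0) = 0) {y : ℝ}
    (hy : y < 0) : ρ.real (Ioi y) = 1 := by
  have h0 : ρ (Iic y) = 0 := measure_mono_null (fun u hu => lt_of_le_of_lt hu hy) h
  rw [← compl_Iic, probReal_compl_eq_one_sub measurableSet_Iic, measureReal_def, h0]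
  simp

theorem integrableOn_measureReal_Ioi {ρ : Measure ℝ} [IsProbabilityMeasure ρ] (h : ρ (Iio 0) = 0)
    (hi : Integrable (fun x : ℝ => x) ρ) :
    IntegrableOn (fun y => ρ.real (Ioi y)) (Ioi 0) := by
  have key := lintegral_eq_lintegral_meas_lt ρ (ae_nonneg_of_Iio_zero h) hi.aemeasurable
  refine ⟨(antitone_measureReal_Ioi ρ).measurable.aestronglyMeasurable, ?_⟩
  rw [hasFiniteIntegral_iff_ofReal (ae_of_all _ fun _ => measureReal_nonneg)]
  have e : ∀ t, ENNReal.ofReal (ρ.real (Ioi t)) = ρ {a | t < a} := fun t => ofReal_measureReal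
  simp_rw [e]
  exact key.symm.trans_lt hi.lintegral_lt_top

theorem integrable_id_of_integrableOn_measureReal_Ioi {ρ : Measure ℝ} [IsProbabilityMeasure ρ]
    (h : ρ (Iio 0) = 0) (hi : IntegrableOn (fun y => ρ.real (Ioi y)) (Ioi 0)) :
    Integrable (fun x : ℝ => x) ρ := by
  have key := lintegral_eq_lintegral_meas_lt ρ (ae_nonneg_of_Iio_zero h) aemeasurable_id
  refine ⟨by fun_prop, ?_⟩
  rw [hasFiniteIntegral_iff_ofReal (ae_nonneg_of_Iio_zero h)]
  refine key.trans_lt ?_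
  have := hi.2
  rw [hasFiniteIntegral_iff_ofReal (ae_of_all _ fun _ => measureReal_nonneg)] at this
  have e : ∀ t, ENNReal.ofReal (ρ.real (Ioi t)) = ρ {a | t < a} := fun t => ofReal_measureReal
  simpa only [e] using this

theorem tendsto_intervalIntegral_measureReal_Ioi {ρ : Measure ℝ} [IsProbabilityMeasure ρ]
    (h : ρ (Iio 0) = 0) (hi : Integrable (fun x : ℝ => x) ρ) :
    Tendsto (fun A => ∫ y in (0 : ℝ)..A, ρ.real (Ioi y)) atTop (𝓝 (∫ x, x ∂ρ)) := by
  rw [hi.integral_eq_integral_meas_lt (ae_nonneg_of_Iio_zero h)]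
  exact intervalIntegral_tendsto_integral_Ioi 0 (integrableOn_measureReal_Ioi h hi) tendsto_id

theorem tendsto_intervalIntegral_neg_one_measureReal_Ioi {ρ : Measure ℝ} [IsProbabilityMeasure ρ]
    (h : ρ (Iio 0) = 0) (hi : Integrable (fun x : ℝ => x) ρ) :
    Tendsto (fun A => ∫ y in (-1 : ℝ)..A, ρ.real (Ioi y)) atTop (𝓝 (1 + ∫ x, x ∂ρ)) := by
  have hint : ∀ a b, IntervalIntegrable (fun y => ρ.real (Ioi y)) volume a b := fun a b =>
    (antitone_measureReal_Ioi ρ).intervalIntegrable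
  have h1 : ∫ y in (-1 : ℝ)..0, ρ.real (Ioi y) = 1 := by
    have : ∫ y in (-1 : ℝ)..0, ρ.real (Ioi y) = ∫ _ in (-1 : ℝ)..0, (1 : ℝ) := by
      rw [intervalIntegral.integral_of_le (by norm_num),
        intervalIntegral.integral_of_le (by norm_num), integral_Ioc_eq_integral_Ioo,
        integral_Ioc_eq_integral_Ioo]
      exact setIntegral_congr_fun measurableSet_Ioo fun y hy => measureReal_Ioi_of_neg h hy.2
    simp [this]
  refine ((tendsto_intervalIntegral_measureReal_Ioi h hi).const_add 1).congr fun A => ?_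
  rw [← intervalIntegral.integral_add_adjacent_intervals (hint (-1) 0) (hint 0 A), h1]

theorem tendsto_intervalIntegral_measureReal_Ioi_add_one {ρ : Measure ℝ} [IsProbabilityMeasure ρ]
    (h : ρ (Iio 0) = 0) (hi : Integrable (fun x : ℝ => x) ρ) :
    Tendsto (fun A => ∫ y in (-1 : ℝ)..A, ρ.real (Ioi (y + 1))) atTop (𝓝 (∫ x, x ∂ρ)) := by
  refine ((tendsto_intervalIntegral_measureReal_Ioi h hi).comp
    (tendsto_atTop_add_const_right atTop 1 tendsto_id)).congr fun A => ?_
  rw [intervalIntegral.integral_comp_add_right fun y => ρ.real (Ioi y)]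
  simp

theorem measureReal_conv_Ioi (ρ μ : Measure ℝ) [IsProbabilityMeasure ρ] [IsProbabilityMeasure μ]
    (x : ℝ) : (ρ.conv μ).real (Ioi x) = ∫ u, ρ.real (Ioi (x - u)) ∂μ := by
  have hi : Integrable ((Ioi x).indicator (1 : ℝ → ℝ)) (μ.conv ρ) :=
    (integrable_indicator_iff measurableSet_Ioi).2 (integrable_const (1 : ℝ)).integrableOn
  rw [Measure.conv_comm, ← integral_indicator_one measurableSet_Ioi, integral_conv hi]
  refine integral_congr_ae (ae_of_all _ fun u => ?_)
  have e : (fun y => (Ioi x).indicator (1 : ℝ → ℝ) (u + y)) = (Ioi (x - u)).indicator 1 := by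
    ext y
    simp only [indicator, mem_Ioi, sub_lt_iff_lt_add']
    rfl
  change ∫ y, (Ioi x).indicator (1 : ℝ → ℝ) (u + y) ∂ρ = _
  rw [e, integral_indicator_one measurableSet_Ioi]

/-! ### Second order tail asymptotics of convolutions -/

theorem integrable_measureReal_Ioi_sub (ρ μ : Measure ℝ) [IsProbabilityMeasure ρ]
    [IsFiniteMeasure μ] (x : ℝ) : Integrable (fun u => ρ.real (Ioi (x - u))) μ := by
  have hm : Monotone fun u => ρ.real (Ioi (x - u)) :=
    fun u v huv => antitone_measureReal_Ioi ρ (by linarith)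
  refine Integrable.of_bound hm.measurable.aestronglyMeasurable 1 (ae_of_all _ fun u => ?_)
  rw [Real.norm_of_nonneg measureReal_nonneg]
  exact measureReal_le_one

theorem measureReal_conv_Ioc (μ : Measure ℝ) [IsProbabilityMeasure μ] (x : ℝ) :
    (μ.conv μ).real (Ioc x (x + 1)) = ∫ u, μ.real (Ioc (x - u) (x - u + 1)) ∂μ := by
  rw [measureReal_Ioc_eq_sub _ (by linarith), measureReal_conv_Ioi, measureReal_conv_Ioi,
    ← integral_sub (integrable_measureReal_Ioi_sub _ _ _) (integrable_measureReal_Ioi_sub _ _ _)]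
  refine integral_congr_ae (ae_of_all _ fun u => ?_)
  change _ = μ.real (Ioc (x - u) (x - u + 1))
  rw [measureReal_Ioc_eq_sub _ (by linarith)]
  simp only [sub_add_eq_add_sub]

/-- The defect of a second order tail expansion of `ν` in terms of `μ`. -/
noncomputable def tailDefect (ν μ : Measure ℝ) (t κ y : ℝ) : ℝ :=
  ν.real (Ioi y) - t * μ.real (Ioi y) - κ * μ.real (Ioc y (y + 1))

/-- Exhibits the defect as a linear combination of antitone functions, to which the window limit
applies termwise. -/
theorem tailDefect_eq (ν μ : Measure ℝ) [IsFiniteMeasure μ] (t κ y : ℝ) :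
    tailDefect ν μ t κ y
      = ν.real (Ioi y) - (t + κ) * μ.real (Ioi y) + κ * μ.real (Ioi (y + 1)) := by
  rw [tailDefect, measureReal_Ioc_eq_sub _ (by linarith : y ≤ y + 1)]
  ring

theorem abs_setIntegral_Iic_tailDefect_sub_le {μ ν : Measure ℝ} [IsProbabilityMeasure μ]
    {t κ ε A : ℝ} (hε : 0 ≤ ε)
    (h : ∀ y, A ≤ y → |tailDefect ν μ t κ y| ≤ ε * μ.real (Ioc y (y + 1))) (x : ℝ) :
    |∫ u in Iic (x - A), tailDefect ν μ t κ (x - u) ∂μ|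
      ≤ ε * (μ.conv μ).real (Ioc x (x + 1)) := by
  have hF : Integrable (fun u => μ.real (Ioc (x - u) (x - u + 1))) μ := by
    have h1 := integrable_measureReal_Ioi_sub μ μ (x + 1)
    simp_rw [← sub_add_eq_add_sub] at h1
    refine ((integrable_measureReal_Ioi_sub μ μ x).sub h1).congr (ae_of_all _ fun u => ?_)
    exact (measureReal_Ioc_eq_sub _ (by linarith)).symm
  rw [measureReal_conv_Ioc, ← integral_const_mul, ← Real.norm_eq_abs]
  refine (norm_integral_le_of_norm_le (hF.const_mul ε).integrableOn ?_).trans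
    (setIntegral_le_integral (hF.const_mul ε)
      (ae_of_all _ fun u => mul_nonneg hε measureReal_nonneg))
  refine (ae_restrict_iff' measurableSet_Iic).2 (ae_of_all _ fun u hu => h _ ?_)
  simp only [mem_Iic] at hu
  linarith

section

variable {μ ν : Measure ℝ} [IsProbabilityMeasure μ] [IsProbabilityMeasure ν]

theorem antitone_measureReal_Ioi_add_one : Antitone fun y => μ.real (Ioi (y + 1)) :=
  fun _ _ h => antitone_measureReal_Ioi μ (by linarith)

theorem integrable_tailDefect_sub (t κ x : ℝ) :
    Integrable (fun u => tailDefect ν μ t κ (x - u)) μ := by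
  simp_rw [tailDefect_eq]
  have h := integrable_measureReal_Ioi_sub μ μ (x + 1)
  simp_rw [← sub_add_eq_add_sub] at h
  exact ((integrable_measureReal_Ioi_sub ν μ x).sub
    ((integrable_measureReal_Ioi_sub μ μ x).const_mul _)).add (h.const_mul _)

theorem integral_tailDefect_sub (t κ x : ℝ) :
    ∫ u, tailDefect ν μ t κ (x - u) ∂μ = (ν.conv μ).real (Ioi x) - t * (μ.conv μ).real (Ioi x)
      - κ * (μ.conv μ).real (Ioc x (x + 1)) := by
  have h := integrable_measureReal_Ioi_sub μ μ (x + 1)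
  simp_rw [tailDefect_eq]
  rw [measureReal_Ioc_eq_sub _ (by linarith : x ≤ x + 1), measureReal_conv_Ioi,
    measureReal_conv_Ioi, measureReal_conv_Ioi]
  simp_rw [← sub_add_eq_add_sub] at h ⊢
  have h' : Integrable (fun u => ν.real (Ioi (x - u)) - (t + κ) * μ.real (Ioi (x - u))) μ :=
    (integrable_measureReal_Ioi_sub ν μ x).sub ((integrable_measureReal_Ioi_sub μ μ x).const_mul _)
  rw [integral_add h' (h.const_mul _),
    integral_sub (integrable_measureReal_Ioi_sub ν μ x)
    ((integrable_measureReal_Ioi_sub μ μ x).const_mul _), integral_const_mul, integral_const_mul]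
  ring

/-- Both `y` and `y + 1` are negative, so every tail involved is `1`; this is why the windows below
start at `-1`. -/
theorem tailDefect_of_lt_neg_one (hμ : μ (Iio 0) = 0) (hν : ν (Iio 0) = 0) (t κ : ℝ) {y : ℝ}
    (hy : y < -1) : tailDefect ν μ t κ y = 1 - t := by
  rw [tailDefect_eq, measureReal_Ioi_of_neg hν (by linarith),
    measureReal_Ioi_of_neg hμ (by linarith), measureReal_Ioi_of_neg hμ (by linarith)]
  ring

theorem tendsto_intervalIntegral_tailDefect_sub_div
    (h : ∀ c : ℝ, 0 < c → IsLocallyLongTailedAt c μ) (t κ a : ℝ) (L : ℕ) :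
    Tendsto (fun x => (∫ u in (x - (a + L))..(x - a), tailDefect ν μ t κ (x - u) ∂μ)
      / μ.real (Ioc x (x + 1))) atTop (𝓝 (∫ y in a..(a + L), tailDefect ν μ t κ y)) := by
  have i : ∀ {g : ℝ → ℝ}, Antitone g → ∀ p q x, IntervalIntegrable (fun u => g (x - u)) μ p q :=
    fun hg _ _ _ => Monotone.intervalIntegrable fun _ _ huv => hg (by linarith)
  have hν := antitone_measureReal_Ioi ν
  have hμ := antitone_measureReal_Ioi μ
  have hμ1 := antitone_measureReal_Ioi_add_one (μ := μ)
  have e : ∀ x, (∫ u in (x - (a + L))..(x - a), tailDefect ν μ t κ (x - u) ∂μ)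
      = (∫ u in (x - (a + L))..(x - a), ν.real (Ioi (x - u)) ∂μ)
        - (t + κ) * (∫ u in (x - (a + L))..(x - a), μ.real (Ioi (x - u)) ∂μ)
        + κ * (∫ u in (x - (a + L))..(x - a), μ.real (Ioi (x - u + 1)) ∂μ) := fun x => by
    simp_rw [tailDefect_eq]
    rw [intervalIntegral.integral_add ((i hν _ _ x).sub ((i hμ _ _ x).const_mul _))
      ((i hμ1 _ _ x).const_mul _), intervalIntegral.integral_sub (i hν _ _ x)
      ((i hμ _ _ x).const_mul _), intervalIntegral.integral_const_mul,
      intervalIntegral.integral_const_mul]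
  have e' : (∫ y in a..(a + L), tailDefect ν μ t κ y)
      = (∫ y in a..(a + L), ν.real (Ioi y)) - (t + κ) * (∫ y in a..(a + L), μ.real (Ioi y))
        + κ * (∫ y in a..(a + L), μ.real (Ioi (y + 1))) := by
    simp_rw [tailDefect_eq]
    rw [intervalIntegral.integral_add
      (hν.intervalIntegrable.sub (hμ.intervalIntegrable.const_mul _))
      (hμ1.intervalIntegrable.const_mul _), intervalIntegral.integral_sub hν.intervalIntegrable
      (hμ.intervalIntegrable.const_mul _), intervalIntegral.integral_const_mul,
      intervalIntegral.integral_const_mul]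
  rw [e']
  refine (((tendsto_intervalIntegral_comp_sub_div h hν a L).sub
    ((tendsto_intervalIntegral_comp_sub_div h hμ a L).const_mul (t + κ))).add
    ((tendsto_intervalIntegral_comp_sub_div h hμ1 a L).const_mul κ)).congr fun x => ?_
  rw [e]
  ring

theorem tendsto_intervalIntegral_tailDefect (hμ : μ (Iio 0) = 0) (hν : ν (Iio 0) = 0)
    (hμi : Integrable (fun x : ℝ => x) μ) (hνi : Integrable (fun x : ℝ => x) ν) (t κ : ℝ) :
    Tendsto (fun A => ∫ y in (-1 : ℝ)..A, tailDefect ν μ t κ y) atTop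
      (𝓝 (1 - t - κ + ((∫ x, x ∂ν) - t * ∫ x, x ∂μ))) := by
  have h := ((tendsto_intervalIntegral_neg_one_measureReal_Ioi hν hνi).sub
    ((tendsto_intervalIntegral_neg_one_measureReal_Ioi hμ hμi).const_mul (t + κ))).add
    ((tendsto_intervalIntegral_measureReal_Ioi_add_one hμ hμi).const_mul κ)
  have aν := antitone_measureReal_Ioi ν
  have aμ := antitone_measureReal_Ioi μ
  have aμ1 := antitone_measureReal_Ioi_add_one (μ := μ)
  convert h using 1
  · ext A
    simp_rw [tailDefect_eq]
    rw [intervalIntegral.integral_add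
      (aν.intervalIntegrable.sub (aμ.intervalIntegrable.const_mul _))
      (aμ1.intervalIntegrable.const_mul _), intervalIntegral.integral_sub aν.intervalIntegrable
      (aμ.intervalIntegrable.const_mul _), intervalIntegral.integral_const_mul,
      intervalIntegral.integral_const_mul]
  · congr 1
    ring

theorem integral_tailDefect_sub_eq_add (hμ : μ (Iio 0) = 0) (hν : ν (Iio 0) = 0) (t κ : ℝ)
    (L : ℕ) (x : ℝ) :
    ∫ u, tailDefect ν μ t κ (x - u) ∂μ
      = (∫ u in Iic (x - (-1 + L)), tailDefect ν μ t κ (x - u) ∂μ)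
        + (∫ u in (x - (-1 + L))..(x - -1), tailDefect ν μ t κ (x - u) ∂μ)
        + (1 - t) * (μ.real (Ioi x) - μ.real (Ioc x (x + 1))) := by
  have hi := integrable_tailDefect_sub (ν := ν) (μ := μ) t κ x
  have hle : x - (-1 + L) ≤ x - -1 := by
    have : (0 : ℝ) ≤ L := L.cast_nonneg
    linarith
  have h3 : ∫ u in Ioi (x - -1), tailDefect ν μ t κ (x - u) ∂μ
      = (1 - t) * (μ.real (Ioi x) - μ.real (Ioc x (x + 1))) := by
    have : ∫ u in Ioi (x - -1), tailDefect ν μ t κ (x - u) ∂μ = ∫ _ in Ioi (x - -1), (1 - t) ∂μ :=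
      setIntegral_congr_fun measurableSet_Ioi fun u hu =>
        tailDefect_of_lt_neg_one hμ hν t κ (by simp only [mem_Ioi] at hu; linarith)
    rw [this, measureReal_Ioc_eq_sub _ (by linarith : x ≤ x + 1)]
    simp [mul_comm]
  have hdisj : Disjoint (Iic (x - (-1 + L))) (Ioc (x - (-1 + L)) (x - -1)) :=
    Set.disjoint_left.2 fun u h1 h2 => not_lt.2 h1 h2.1
  rw [← h3, intervalIntegral.integral_of_le hle, ← setIntegral_union hdisj measurableSet_Ioc
    hi.integrableOn hi.integrableOn, Iic_union_Ioc_eq_Iic hle,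
    intervalIntegral.integral_Iic_add_Ioi hi.integrableOn hi.integrableOn]

/-- If the tail of `ν` has a second order expansion in terms of `μ`, then so does the tail of
`ν * μ`, in terms of `μ` and `μ * μ`. -/
theorem tendsto_conv_tail_sub_div (hloc : IsLocallySubexponential μ) (hμ : μ (Iio 0) = 0)
    (hν : ν (Iio 0) = 0) (hμi : Integrable (fun x : ℝ => x) μ)
    (hνi : Integrable (fun x : ℝ => x) ν) {t κ : ℝ}
    (hexp : tailDefect ν μ t κ =o[atTop] fun x => μ.real (Ioc x (x + 1))) :
    Tendsto (fun x => ((ν.conv μ).real (Ioi x) - t * (μ.conv μ).real (Ioi x)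
      - κ * (μ.conv μ).real (Ioc x (x + 1)) - (1 - t) * μ.real (Ioi x)) / μ.real (Ioc x (x + 1)))
      atTop (𝓝 (-κ + ((∫ x, x ∂ν) - t * ∫ x, x ∂μ))) := by
  obtain ⟨⟨-, hF0, hFlong⟩, hFconv⟩ := hloc 1 one_pos
  have hFpos := eventually_pos_of_tendsto_div one_ne_zero hF0 (hFlong 0)
  have hlong : ∀ c : ℝ, 0 < c → IsLocallyLongTailedAt c μ := fun c hc => (hloc c hc).1
  rw [Metric.tendsto_atTop']
  intro ε hε
  -- The local mass of `μ * μ` will be below `3` times that of `μ`, so `ε / 12` costs `ε / 4`.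
  obtain ⟨Y, hY⟩ := eventually_atTop.1 (hexp.def (show (0 : ℝ) < ε / 12 by positivity))
  have hH : Tendsto (fun L : ℕ => ∫ y in (-1 : ℝ)..(-1 + L), tailDefect ν μ t κ y) atTop
      (𝓝 (1 - t - κ + ((∫ x, x ∂ν) - t * ∫ x, x ∂μ))) :=
    (tendsto_intervalIntegral_tailDefect hμ hν hμi hνi t κ).comp
      (tendsto_atTop_add_const_left _ _ tendsto_natCast_atTop_atTop)
  -- `L` is fixed before `x` grows: the window must capture `∫ D` up to `ε / 4` and end beyond `Y`.
  obtain ⟨L, hL1, hL2⟩ := ((Metric.tendsto_nhds.1 hH (ε / 4) (by positivity)).and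
    ((tendsto_atTop_add_const_left _ (-1 : ℝ) tendsto_natCast_atTop_atTop).eventually_ge_atTop
      Y)).exists
  have hM := tendsto_intervalIntegral_tailDefect_sub_div (ν := ν) hlong t κ (-1) L
  have hev : ∀ᶠ x in atTop, dist (((ν.conv μ).real (Ioi x) - t * (μ.conv μ).real (Ioi x)
      - κ * (μ.conv μ).real (Ioc x (x + 1)) - (1 - t) * μ.real (Ioi x)) / μ.real (Ioc x (x + 1)))
      (-κ + ((∫ x, x ∂ν) - t * ∫ x, x ∂μ)) < ε := by
    filter_upwards [Metric.tendsto_nhds.1 hM (ε / 4) (by positivity), hFpos,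
      hFconv.eventually_lt_const (show (1 : ℝ) < 3 / 2 by norm_num)] with x hx1 hx2 hx3
    rw [← integral_tailDefect_sub, integral_tailDefect_sub_eq_add hμ hν t κ L]
    have hfirst := abs_setIntegral_Iic_tailDefect_sub_le (μ := μ) (ν := ν) (t := t) (κ := κ)
      (A := -1 + L) (show (0 : ℝ) ≤ ε / 12 by positivity) (fun y hy => by
        have := hY y (hL2.trans hy)
        rwa [Real.norm_eq_abs, Real.norm_of_nonneg measureReal_nonneg] at this) x
    rw [div_lt_iff₀ (by positivity)] at hx3
    have hfirst' : |(∫ u in Iic (x - (-1 + L)), tailDefect ν μ t κ (x - u) ∂μ)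
        / μ.real (Ioc x (x + 1))| ≤ ε / 4 := by
      rw [abs_div, abs_of_pos hx2, div_le_iff₀ hx2]
      refine hfirst.trans ?_
      nlinarith
    have e : ((∫ u in Iic (x - (-1 + L)), tailDefect ν μ t κ (x - u) ∂μ)
        + (∫ u in (x - (-1 + L))..(x - -1), tailDefect ν μ t κ (x - u) ∂μ)
        + (1 - t) * (μ.real (Ioi x) - μ.real (Ioc x (x + 1))) - (1 - t) * μ.real (Ioi x))
          / μ.real (Ioc x (x + 1))
        = (∫ u in Iic (x - (-1 + L)), tailDefect ν μ t κ (x - u) ∂μ) / μ.real (Ioc x (x + 1))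
          + (∫ u in (x - (-1 + L))..(x - -1), tailDefect ν μ t κ (x - u) ∂μ)
            / μ.real (Ioc x (x + 1)) - (1 - t) := by
      field_simp
      ring
    rw [e]
    rw [Real.dist_eq, abs_lt] at *
    rw [abs_le] at hfirst'
    constructor <;> linarith [hfirst'.1, hfirst'.2, hx1.1, hx1.2, hL1.1, hL1.2]
  obtain ⟨N, hN⟩ := eventually_atTop.1 hev
  exact ⟨N, fun x hx => hN x hx.le⟩

/-- A distribution whose tail is eventually dominated, up to a constant, by that of an integrable
one is integrable. -/
theorem integrable_id_of_tailDefect_isLittleO (hμ : μ (Iio 0) = 0) (hν : ν (Iio 0) = 0)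
    (hμi : Integrable (fun x : ℝ => x) μ) {t κ : ℝ}
    (hexp : tailDefect ν μ t κ =o[atTop] fun x => μ.real (Ioc x (x + 1))) :
    Integrable (fun x : ℝ => x) ν := by
  refine integrable_id_of_integrableOn_measureReal_Ioi hν ?_
  obtain ⟨Y, hY⟩ := eventually_atTop.1 (hexp.def one_pos)
  have hT := integrableOn_measureReal_Ioi hμ hμi
  have hI : IntegrableOn ((Iic Y).indicator fun _ => (1 : ℝ)) (Ioi 0) := by
    rw [IntegrableOn, integrable_indicator_iff measurableSet_Iic, IntegrableOn,
      Measure.restrict_restrict measurableSet_Iic, inter_comm, Ioi_inter_Iic]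
    exact integrableOn_const (by simp)
  -- Up to `Y` the tail is at most `1`; past `Y` the defect is at most `F ≤ μ̄`, hence the factor
  -- `|t| + |κ| + 1`.
  refine (hI.add (hT.const_mul (|t| + |κ| + 1))).mono'
    (antitone_measureReal_Ioi ν).measurable.aestronglyMeasurable (ae_of_all _ fun y => ?_)
  have hT0 : 0 ≤ μ.real (Ioi y) := measureReal_nonneg
  rw [Real.norm_of_nonneg measureReal_nonneg, Pi.add_apply]
  by_cases hy : y ≤ Y
  · rw [indicator_of_mem (by exact hy)]
    have : ν.real (Ioi y) ≤ 1 := measureReal_le_one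
    have : 0 ≤ (|t| + |κ| + 1) * μ.real (Ioi y) := by positivity
    linarith
  · rw [indicator_of_notMem (by exact hy), zero_add]
    have h1 := hY y (not_le.1 hy).le
    have hF0 : 0 ≤ μ.real (Ioc y (y + 1)) := measureReal_nonneg
    have hFT : μ.real (Ioc y (y + 1)) ≤ μ.real (Ioi y) := measureReal_mono Ioc_subset_Ioi_self
    rw [Real.norm_eq_abs, Real.norm_of_nonneg hF0, one_mul, tailDefect] at h1
    have h2 := (abs_le.1 h1).2
    have h3 : t * μ.real (Ioi y) ≤ |t| * μ.real (Ioi y) := by gcongr; exact le_abs_self t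
    have h4 : κ * μ.real (Ioc y (y + 1)) ≤ |κ| * μ.real (Ioi y) :=
      (mul_le_mul_of_nonneg_right (le_abs_self κ) hF0).trans
        (mul_le_mul_of_nonneg_left hFT (abs_nonneg κ))
    linarith

end

theorem mainTheorem8 (μ : Measure ℝ) [IsProbabilityMeasure μ]
    (hsupp : μ (Iio 0) = 0)
    (hdiv : IsInfinitelyDivisible μ)
    (hloc : IsLocallySubexponential μ)
    (hmean : Integrable (fun x : ℝ => x) μ)
    (t₀ : ℝ) (ht₀ : 0 < t₀)
    (hexp₀ : HasConvPowTailExpansion μ t₀)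
    (hexp₁ : HasConvPowTailExpansion μ (t₀ + 1)) :
    IsSecondOrderSubexponential μ := by
  obtain ⟨ν, hν, hν0⟩ := exists_isRealConvPow hdiv hsupp ht₀
  have hνp : IsProbabilityMeasure ν := hν.1
  rw [HasConvPowTailExpansion, hν.realConvPow_eq] at hexp₀
  rw [HasConvPowTailExpansion, hν.conv_self.realConvPow_eq] at hexp₁
  set m := ∫ y, y ∂μ with hm
  have hdefect : tailDefect ν μ t₀ ((t₀ ^ 2 - t₀) * m) =o[atTop]
      fun x => μ.real (Ioc x (x + 1)) :=
    hexp₀.congr_left fun x => by rw [tailDefect]; ring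
  have hνi := integrable_id_of_tailDefect_isLittleO hsupp hν0 hmean hdefect
  have hmν : ∫ x, x ∂ν = t₀ * m := hν.integral_id hmean hνi
  have hconv := tendsto_conv_tail_sub_div hloc hsupp hν0 hmean hνi hdefect
  rw [hmν, ← hm, sub_self, add_zero] at hconv
  obtain ⟨⟨-, hF0, hFlong⟩, hFconv⟩ := hloc 1 one_pos
  have hFpos := eventually_pos_of_tendsto_div one_ne_zero hF0 (hFlong 0)
  refine ⟨hloc, hmean, ?_⟩
  rw [Asymptotics.isLittleO_iff_tendsto' (hFpos.mono fun x hx h => absurd h hx.ne')]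
  -- The difference eliminates the tail of `ν * μ`; subtracting `2 κ` times the ratio in `hFconv`
  -- removes the local mass of `μ * μ`. What remains is `t₀` times the desired quotient.
  have h := ((hexp₁.tendsto_div_nhds_zero.sub hconv).sub
    (hFconv.const_mul (2 * ((t₀ ^ 2 - t₀) * m)))).add_const ((t₀ ^ 2 - t₀) * m)
  have h' := h.const_mul t₀⁻¹
  rw [show t₀⁻¹ * (0 - -((t₀ ^ 2 - t₀) * m) - 2 * ((t₀ ^ 2 - t₀) * m) * 1 + (t₀ ^ 2 - t₀) * m) = 0
    by ring] at h'
  refine h'.congr' ?_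
  filter_upwards [hFpos] with x hx
  field_simp
  ring
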